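/- Let $n\in\mathbb N$, let $A$ be a real symmetric $n\times n$ matrix, $a,b\in\mathbb R^n\setminus\{0\}$, $\beta\in\mathbb R$, $\delta>0$. Consider the extended trust region subproblem $$\text{(eTRS)}\qquad p^*=\min\{\,q(x):=x^TAx+2a^Tx \;:\; \|x\|^2\le\delta,\ b^Tx\le\beta\,\},$$ and assume that it is strictly feasible: there is $x$ with $\|x\|^2<\delta$ and $b^Tx<\beta$. Let $$d^*=\sup_{\mu\ge 0} g(\mu),\qquad g(\mu)=\sup_{\lambda\ge0}\ \inf_{x\in\mathbb R^n}\bigl[q(x)+\lambda(\|x\|^2-\delta)+\mu b^Tx\bigr]-\mu\beta ,$$ be the value of its Lagrangian dual. Strong duality for eTRS means $p^*=d^*$. Let $\lambda_1$ be the smallest eigenvalue of $A$. For $\mu>0$ let TRS$_\mu$ be the problem of minimizing $q(x)+\mu b^Tx-\mu\beta$ over $\|x\|^2\le\delta$. Call $x_\mu$ a hard-case solution of TRS$_\mu$ (for eTRS) if the following hold: * (hard case) $a+\frac{\mu}{2}b$ is orthogonal to the eigenspace of $A$ for $\lambda_1$; * with the multiplier $\lambda=-\lambda_1$, $x_\mu$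 satisfies all the optimality conditions of TRS$_\mu$ except for complementary slackness, which fails: $\lambda\ge0$, $A+\lambda I\succeq0$, $(A+\lambda I)x_\mu=-(a+\frac{\mu}{2}b)$, $\|x_\mu\|^2\le\delta$, but $\lambda(\|x_\mu\|^2-\delta)\neq0$; that is, $\lambda>0$ and $\|x_\mu\|^2<\delta$; * $b^Tx_\mu=\beta$. Then: 1. If strong duality fails for eTRS, there is $\mu>0$ for which TRS$_\mu$ has a hard-case solution. 2. Suppose that $\lambda_1\ge0$, or that no eigenvector of $A$ for $\lambda_1$ is orthogonal to both $a$ and $b$ (this holds, for example, if $\lambda_1$ is a simple eigenvalue and $a$ is not orthogonal to its eigenvectors). Then strong duality fails for eTRS if and only if there is $\mu>0$ for which TRS$_\mu$ has a hard-case solution. -/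

import Mathlib

open Matrix

/-! The extended trust region subproblem: minimize `xᵀ A x + 2 aᵀ x` subject to
`‖x‖² ≤ δ` and `bᵀ x ≤ β`. Vectors are functions `Fin n → ℝ`, and the squared Euclidean
norm is the dot product `x ⬝ᵥ x`. -/

namespace ETRS

noncomputable section

variable {n : ℕ}

/-- The quadratic objective `q(x) = xᵀ A x + 2 aᵀ x`. -/
def q (A : Matrix (Fin n) (Fin n) ℝ) (a x : Fin n → ℝ) : ℝ :=
  x ⬝ᵥ (A *ᵥ x) + 2 * (a ⬝ᵥ x)

/-- The feasible set of eTRS. -/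
def feasible (b : Fin n → ℝ) (δ β : ℝ) : Set (Fin n → ℝ) :=
  {x | x ⬝ᵥ x - δ ≤ 0 ∧ b ⬝ᵥ x - β ≤ 0}

/-- The optimal value `p*` of eTRS. -/
def pStar (A : Matrix (Fin n) (Fin n) ℝ) (a b : Fin n → ℝ) (δ β : ℝ) : EReal :=
  ⨅ x ∈ feasible b δ β, (q A a x : EReal)

/-- The Lagrangian `L(x, l) = q(x) + l (‖x‖² - δ)` of TRS. -/
def lagrangian (A : Matrix (Fin n) (Fin n) ℝ) (a : Fin n → ℝ) (δ : ℝ)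
    (x : Fin n → ℝ) (l : ℝ) : ℝ :=
  q A a x + l * (x ⬝ᵥ x - δ)

/-- The dual function `g(μ) = sup_{l ≥ 0} inf_x [L(x, l) + μ bᵀ x] - μ β`. -/
def dualFun (A : Matrix (Fin n) (Fin n) ℝ) (a b : Fin n → ℝ) (δ β μ : ℝ) : EReal :=
  (⨆ (l : ℝ) (_ : 0 ≤ l), ⨅ x : Fin n → ℝ,
    ((lagrangian A a δ x l + μ * (b ⬝ᵥ x) : ℝ) : EReal)) - ((μ * β : ℝ) : EReal)

/-- The dual optimal value `d* = sup_{μ ≥ 0} g(μ)`. -/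
def dStar (A : Matrix (Fin n) (Fin n) ℝ) (a b : Fin n → ℝ) (δ β : ℝ) : EReal :=
  ⨆ (μ : ℝ) (_ : 0 ≤ μ), dualFun A a b δ β μ

/-- Strong Lagrangian duality for eTRS: the primal and dual optimal values agree. -/
def StrongDuality (A : Matrix (Fin n) (Fin n) ℝ) (a b : Fin n → ℝ) (δ β : ℝ) : Prop :=
  pStar A a b δ β = dStar A a b δ β

/-- The smallest eigenvalue of a symmetric matrix (of positive size). -/
def lamMin (A : Matrix (Fin n) (Fin n) ℝ) : ℝ := sInf (spectrum ℝ A)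

/-- The hard case for the trust region subproblem with objective `xᵀ A x + 2 cᵀ x`:
`c` is orthogonal to the eigenspace of the smallest eigenvalue of `A`. -/
def HardCase (A : Matrix (Fin n) (Fin n) ℝ) (c : Fin n → ℝ) : Prop :=
  ∀ v : Fin n → ℝ, A *ᵥ v = lamMin A • v → c ⬝ᵥ v = 0

/-- The linear term of TRS_μ: `q(x) + μ bᵀ x = xᵀ A x + 2 (a + (μ/2) b)ᵀ x`. -/
def shifted (a b : Fin n → ℝ) (μ : ℝ) : Fin n → ℝ := a + (μ / 2) • b

/-- `x` is a hard-case solution of TRS_μ: the hard case holds for TRS_μ, and `x`, with the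
multiplier `l = -λ_min(A)`, satisfies every optimality condition of TRS_μ except for
complementary slackness, which fails; moreover `‖x‖² < δ` and `bᵀ x = β`. -/
structure IsHardCaseSolution (A : Matrix (Fin n) (Fin n) ℝ) (a b : Fin n → ℝ)
    (δ β μ : ℝ) (x : Fin n → ℝ) : Prop where
  hardCase : HardCase A (shifted a b μ)
  optimality : ∃ l : ℝ, l = -lamMin A ∧ 0 ≤ l ∧
    (A + l • (1 : Matrix (Fin n) (Fin n) ℝ)).PosSemidef ∧
    (A + l • (1 : Matrix (Fin n) (Fin n) ℝ)) *ᵥ x = -shifted a b μ ∧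
    l * (x ⬝ᵥ x - δ) ≠ 0
  normSq_lt : x ⬝ᵥ x < δ
  linear_eq : b ⬝ᵥ x = β

end

end ETRS

/-!
The shift `l = -lamMin A` makes `A + l • 1` positive semidefinite, so that
`f x = q A a x + l * (x ⬝ᵥ x - δ)` is a convex function which, for `l ≥ 0`, lies below `q A a` on
the feasible set. A Slater argument (`exists_multipliers`, by separation in `ℝ × ℝ × ℝ`) shows
that the minimum of `f` over the feasible set is at most the dual value
(`exists_minimizer_multipliers`); it is the dual value, since a multiplier below `-lamMin A` makes
the inner infimum `-∞` (`neg_lamMin_le_of_bddBelow`).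

Suppose duality fails. Then `l > 0`, and no minimizer `z` of `f` lies on the sphere, because there
`f` and `q A a` agree. Hence the multiplier of the ball vanishes, and with the multiplier `μ` of the
half-space, `z` is a stationary point: `(A + l • 1) *ᵥ z = -shifted a b μ`. If `μ` were zero, `a`
would be orthogonal to the eigenspace of `lamMin A`, and moving from `z` along an eigenvector, in
the direction that does not increase `b ⬝ᵥ ·`, would keep `f` constant until the sphere is reached.
So `μ > 0`, and `z` is a hard-case solution (`exists_isHardCaseSolution_of_not_strongDuality`).

Conversely, a hard-case solution `x` minimizes the Lagrangian with the multipliers `l` and `μ`, and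
if duality holds, so does a solution `y` of the primal problem; moreover `y` lies on the sphere and
satisfies `b ⬝ᵥ y = β`. Then `y - x` is an eigenvector for `lamMin A` (or zero) that is orthogonal
to `b`, and by the hard case also to `a`. The assumption on eigenvectors leaves only `y = x`, which
contradicts `x ⬝ᵥ x < δ` (`not_strongDuality_of_isHardCaseSolution`).
-/

namespace ETRS

/-! ### Lagrange multipliers for two convex constraints -/

theorem nonneg_of_forall_pos_add_mul_nonneg {c p : ℝ} (h : ∀ t : ℝ, 0 < t → 0 ≤ c + t * p) :
    0 ≤ c ∧ 0 ≤ p := by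
  constructor
  · by_contra! hc
    have hd : 0 < |p| + 1 := by positivity
    have h1 := h (-c / (2 * (|p| + 1))) (div_pos (by linarith) (by positivity))
    have h2 : -c / (2 * (|p| + 1)) * p ≤ -c / (2 * (|p| + 1)) * (|p| + 1) :=
      mul_le_mul_of_nonneg_left (by linarith [le_abs_self p])
        (div_pos (by linarith) (by positivity)).le
    have h3 : -c / (2 * (|p| + 1)) * (|p| + 1) = -c / 2 := by field_simp
    linarith
  · by_contra! hp
    have h1 := h ((|c| + 1) / -p) (div_pos (by positivity) (by linarith))
    have h2 : (|c| + 1) / -p * p = -(|c| + 1) := by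
      have : p ≠ 0 := hp.ne
      field_simp
    linarith [le_abs_self c]

/-- Lagrange multipliers exist for a convex problem with two constraints under Slater's
condition. -/
theorem exists_multipliers {E : Type*} [AddCommGroup E] [Module ℝ E] {f g h : E → ℝ}
    (hf : ConvexOn ℝ Set.univ f) (hg : ConvexOn ℝ Set.univ g) (hh : ConvexOn ℝ Set.univ h)
    {m : ℝ} (hm : ∀ x, g x ≤ 0 → h x ≤ 0 → m ≤ f x) (hs : ∃ x, g x < 0 ∧ h x < 0) :
    ∃ l μ : ℝ, 0 ≤ l ∧ 0 ≤ μ ∧ ∀ x, m ≤ f x + l * g x + μ * h x := by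
  let S : Set (ℝ × ℝ × ℝ) := {p | ∃ x, f x - m < p.1 ∧ g x < p.2.1 ∧ h x < p.2.2}
  have hconv : Convex ℝ S := by
    rintro ⟨r, s, t⟩ ⟨x, hx1, hx2, hx3⟩ ⟨r', s', t'⟩ ⟨y, hy1, hy2, hy3⟩ α γ hα hγ hαγ
    have key : ∀ {u v u' v' : ℝ}, u < v → u' < v' → α * u + γ * u' < α * v + γ * v' := by
      intro u v u' v' huv huv'
      rcases hα.eq_or_lt with rfl | hα'
      · obtain rfl : γ = 1 := by linarith
        linarith
      · linarith [mul_lt_mul_of_pos_left huv hα', mul_le_mul_of_nonneg_left huv'.le hγ]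
    refine ⟨α • x + γ • y, ?_, ?_, ?_⟩
    · have h1 := hf.2 (Set.mem_univ x) (Set.mem_univ y) hα hγ hαγ
      have h2 := key hx1 hy1
      simp only [smul_eq_mul, Prod.smul_mk, Prod.mk_add_mk] at *
      have h3 : α * (f x - m) + γ * (f y - m) = α * f x + γ * f y - m := by
        linear_combination (-m) * hαγ
      linarith
    · have h1 := hg.2 (Set.mem_univ x) (Set.mem_univ y) hα hγ hαγ
      exact h1.trans_lt (key hx2 hy2)
    · have h1 := hh.2 (Set.mem_univ x) (Set.mem_univ y) hα hγ hαγ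
      exact h1.trans_lt (key hx3 hy3)
  have hopen : IsOpen S := by
    have hS : S = ⋃ x, {p : ℝ × ℝ × ℝ | f x - m < p.1} ∩
        ({p | g x < p.2.1} ∩ {p | h x < p.2.2}) := by
      ext p
      simp [S]
    rw [hS]
    refine isOpen_iUnion fun x => ?_
    exact (isOpen_lt continuous_const (by fun_prop)).inter
      ((isOpen_lt continuous_const (by fun_prop)).inter (isOpen_lt continuous_const (by fun_prop)))
  have h0 : (0 : ℝ × ℝ × ℝ) ∉ S := by
    rintro ⟨x, hx1, hx2, hx3⟩
    have := hm x hx2.le hx3.le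
    simp only [Prod.fst_zero] at hx1
    linarith
  obtain ⟨φ, hφ⟩ := geometric_hahn_banach_point_open hconv hopen h0
  set p := φ (1, 0, 0)
  set r := φ (0, 1, 0)
  set w := φ (0, 0, 1)
  have hdec : ∀ u v t : ℝ, φ (u, v, t) = u * p + v * r + t * w := by
    intro u v t
    have : ((u, v, t) : ℝ × ℝ × ℝ) = u • (1, 0, 0) + v • (0, 1, 0) + t • (0, 0, 1) := by
      simp
    rw [this, map_add, map_add, map_smul, map_smul, map_smul]
    rfl
  have hpos : ∀ x, ∀ α κ γ : ℝ, 0 < α → 0 < κ → 0 < γ →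
      0 < (f x - m + α) * p + (g x + κ) * r + (h x + γ) * w := by
    intro x α κ γ hα hκ hγ
    rw [← hdec]
    have := hφ (f x - m + α, g x + κ, h x + γ)
      ⟨x, by simpa using hα, by simpa using hκ, by simpa using hγ⟩
    rwa [map_zero] at this
  obtain ⟨x₀, hg₀, hh₀⟩ := hs
  have hp0 : 0 ≤ p := by
    refine (nonneg_of_forall_pos_add_mul_nonneg
      (c := (f x₀ - m) * p + (g x₀ + 1) * r + (h x₀ + 1) * w) fun t ht => ?_).2
    linarith [hpos x₀ t 1 1 ht one_pos one_pos]
  have hr0 : 0 ≤ r := by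
    refine (nonneg_of_forall_pos_add_mul_nonneg
      (c := (f x₀ - m + 1) * p + g x₀ * r + (h x₀ + 1) * w) fun t ht => ?_).2
    linarith [hpos x₀ 1 t 1 one_pos ht one_pos]
  have hw0 : 0 ≤ w := by
    refine (nonneg_of_forall_pos_add_mul_nonneg
      (c := (f x₀ - m + 1) * p + (g x₀ + 1) * r + h x₀ * w) fun t ht => ?_).2
    linarith [hpos x₀ 1 1 t one_pos one_pos ht]
  have hbase : ∀ x, 0 ≤ (f x - m) * p + g x * r + h x * w := by
    intro x
    refine (nonneg_of_forall_pos_add_mul_nonneg (p := p + r + w) fun t ht => ?_).1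
    linarith [hpos x t t t ht ht ht]
  have hppos : 0 < p := by
    refine hp0.lt_of_ne fun hpz => ?_
    -- The Slater point puts `(f x₀ - m + 1, 0, 0)` into `S`, where `φ` vanishes if `p = 0`.
    have h1 := hpos x₀ 1 (-g x₀) (-h x₀) one_pos (by linarith) (by linarith)
    rw [← hpz] at h1
    simp at h1
  refine ⟨r / p, w / p, div_nonneg hr0 hp0, div_nonneg hw0 hp0, fun x => ?_⟩
  have h1 : f x + r / p * g x + w / p * h x - m
      = ((f x - m) * p + g x * r + h x * w) / p := by
    field_simp
    ring
  have h2 := div_nonneg (hbase x) hp0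
  linarith

/-! ### Quadratic functions -/

section quadratic

variable {n : ℕ}

theorem isSymm_add_smul_one {A : Matrix (Fin n) (Fin n) ℝ} (hA : A.IsSymm) (l : ℝ) :
    (A + l • (1 : Matrix (Fin n) (Fin n) ℝ)).IsSymm :=
  hA.add (Matrix.isSymm_one.smul l)

theorem dotProduct_mulVec_symm {M : Matrix (Fin n) (Fin n) ℝ} (hM : M.IsSymm)
    (x y : Fin n → ℝ) : x ⬝ᵥ (M *ᵥ y) = (M *ᵥ x) ⬝ᵥ y := by
  rw [Matrix.dotProduct_mulVec, ← Matrix.mulVec_transpose, hM.eq]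

/-- The Lagrangian of eTRS is, up to a constant, again a quadratic function. -/
theorem q_add_smul_one_shifted (A : Matrix (Fin n) (Fin n) ℝ) (a b x : Fin n → ℝ) (l μ : ℝ) :
    q (A + l • (1 : Matrix (Fin n) (Fin n) ℝ)) (shifted a b μ) x
      = q A a x + l * (x ⬝ᵥ x) + μ * (b ⬝ᵥ x) := by
  simp only [q, shifted, Matrix.add_mulVec, Matrix.smul_mulVec, Matrix.one_mulVec,
    dotProduct_add, add_dotProduct, dotProduct_smul, smul_dotProduct, smul_eq_mul]
  ring

theorem q_add_smul_one (A : Matrix (Fin n) (Fin n) ℝ) (a x : Fin n → ℝ) (l : ℝ) :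
    q (A + l • (1 : Matrix (Fin n) (Fin n) ℝ)) a x = q A a x + l * (x ⬝ᵥ x) := by
  simpa [shifted] using q_add_smul_one_shifted A a 0 x l 0

theorem q_add {M : Matrix (Fin n) (Fin n) ℝ} (hM : M.IsSymm) (c x d : Fin n → ℝ) :
    q M c (x + d) = q M c x + 2 * ((M *ᵥ x + c) ⬝ᵥ d) + d ⬝ᵥ (M *ᵥ d) := by
  have h1 := dotProduct_mulVec_symm hM x d
  have h2 := dotProduct_comm d (M *ᵥ x)
  simp only [q, Matrix.mulVec_add, dotProduct_add, add_dotProduct, h1, h2]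
  ring

theorem q_add_smul {M : Matrix (Fin n) (Fin n) ℝ} (hM : M.IsSymm) (c x d : Fin n → ℝ) (t : ℝ) :
    q M c (x + t • d) =
      q M c x + 2 * t * ((M *ᵥ x + c) ⬝ᵥ d) + t ^ 2 * (d ⬝ᵥ (M *ᵥ d)) := by
  rw [q_add hM, Matrix.mulVec_smul, dotProduct_smul, dotProduct_smul, smul_dotProduct]
  simp only [smul_eq_mul]
  ring

theorem dotProduct_add_smul_self (z v : Fin n → ℝ) (t : ℝ) :
    (z + t • v) ⬝ᵥ (z + t • v) = z ⬝ᵥ z + 2 * t * (z ⬝ᵥ v) + t ^ 2 * (v ⬝ᵥ v) := by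
  have h := dotProduct_comm v z
  simp only [dotProduct_add, add_dotProduct, dotProduct_smul, smul_dotProduct, smul_eq_mul, h]
  ring

theorem continuous_q (M : Matrix (Fin n) (Fin n) ℝ) (c : Fin n → ℝ) : Continuous (q M c) := by
  unfold q
  fun_prop

theorem posSemidef_dotProduct_nonneg {M : Matrix (Fin n) (Fin n) ℝ} (hM : M.PosSemidef)
    (x : Fin n → ℝ) : 0 ≤ x ⬝ᵥ (M *ᵥ x) := by
  simpa using hM.dotProduct_mulVec_nonneg x

theorem convexOn_q {M : Matrix (Fin n) (Fin n) ℝ} (hM : M.PosSemidef) (c : Fin n → ℝ) :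
    ConvexOn ℝ Set.univ (q M c) := by
  have hsymm : M.IsSymm := by simpa using hM.isHermitian
  refine ⟨convex_univ, fun x _ y _ α γ hα hγ hαγ => ?_⟩
  obtain rfl : α = 1 - γ := by linarith
  -- Both `q M c y` and the value at the convex combination are expanded around `x`.
  have h1 : (1 - γ) • x + γ • y = x + γ • (y - x) := by module
  have h2 := q_add hsymm c x (y - x)
  rw [add_sub_cancel] at h2
  rw [h1, q_add_smul hsymm, h2, smul_eq_mul, smul_eq_mul]
  have h3 := mul_nonneg (mul_nonneg hγ hα) (posSemidef_dotProduct_nonneg hM (y - x))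
  linarith

theorem mulVec_add_eq_zero_of_forall_le {M : Matrix (Fin n) (Fin n) ℝ} (hM : M.IsSymm)
    {c z : Fin n → ℝ} (h : ∀ x, q M c z ≤ q M c x) : M *ᵥ z + c = 0 := by
  set g := M *ᵥ z + c with hg
  have h1 : 0 ≤ -2 * (g ⬝ᵥ g) := by
    refine (nonneg_of_forall_pos_add_mul_nonneg (p := g ⬝ᵥ (M *ᵥ g)) fun t ht => ?_).1
    have h2 := h (z + (-t) • g)
    rw [q_add_smul hM, ← hg] at h2
    have h3 : 0 ≤ t * (-2 * (g ⬝ᵥ g) + t * (g ⬝ᵥ (M *ᵥ g))) := by linarith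
    exact nonneg_of_mul_nonneg_right h3 ht
  have h2 : 0 ≤ g ⬝ᵥ g := Finset.sum_nonneg fun i _ => mul_self_nonneg (g i)
  exact dotProduct_self_eq_zero.mp (by linarith)

theorem dotProduct_mulVec_nonneg_of_bddBelow {M : Matrix (Fin n) (Fin n) ℝ} (hM : M.IsSymm)
    {c : Fin n → ℝ} {r : ℝ} (h : ∀ x, r ≤ q M c x) (v : Fin n → ℝ) : 0 ≤ v ⬝ᵥ (M *ᵥ v) := by
  refine (nonneg_of_forall_pos_add_mul_nonneg (c := q M c 0 - r) fun t ht => ?_).2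
  have h1 := h (0 + √t • v)
  have h2 := h (0 + (-√t) • v)
  rw [q_add_smul hM] at h1 h2
  rw [neg_sq] at h2
  rw [Real.sq_sqrt ht.le] at h1 h2
  linarith

end quadratic

/-! ### The smallest eigenvalue -/

section eigenvalue

variable {n : ℕ} {A : Matrix (Fin n) (Fin n) ℝ}

theorem exists_eigenvector_lamMin [NeZero n] (hA : A.IsSymm) :
    ∃ v : Fin n → ℝ, v ≠ 0 ∧ A *ᵥ v = lamMin A • v := by
  have hH : A.IsHermitian := by simpa using hA
  have hne : (spectrum ℝ A).Nonempty := by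
    rw [hH.spectrum_real_eq_range_eigenvalues]
    exact Set.range_nonempty _
  have hmem : lamMin A ∈ spectrum ℝ A := hne.csInf_mem A.finite_real_spectrum
  rw [hH.spectrum_real_eq_range_eigenvalues] at hmem
  obtain ⟨i, hi⟩ := hmem
  refine ⟨hH.eigenvectorBasis i, fun h0 => ?_, ?_⟩
  · refine hH.eigenvectorBasis.orthonormal.ne_zero i ?_
    ext j
    simpa using congrFun h0 j
  · rw [← hi]
    exact hH.mulVec_eigenvectorBasis i

theorem posSemidef_add_smul_one (hA : A.IsSymm) {l : ℝ} (hl : -lamMin A ≤ l) :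
    (A + l • (1 : Matrix (Fin n) (Fin n) ℝ)).PosSemidef := by
  have hH : A.IsHermitian := by simpa using hA
  rw [Matrix.posSemidef_iff_isHermitian_and_spectrum_nonneg]
  refine ⟨by simpa using isSymm_add_smul_one hA l, fun s hs => ?_⟩
  rw [← Algebra.algebraMap_eq_smul_one, add_comm, ← spectrum.singleton_add_eq] at hs
  obtain ⟨_, rfl, t, ht, rfl⟩ := hs
  have : lamMin A ≤ t := csInf_le A.finite_real_spectrum.bddBelow ht
  simp only [Set.mem_ofPred_eq]
  linarith

/-- A Lagrangian that is bounded below has a ball multiplier of at least `-lamMin A`. -/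
theorem neg_lamMin_le_of_bddBelow [NeZero n] (hA : A.IsSymm) {a b : Fin n → ℝ} {δ β l μ r : ℝ}
    (h : ∀ x, r ≤ lagrangian A a δ x l + μ * (b ⬝ᵥ x - β)) : -lamMin A ≤ l := by
  obtain ⟨v, hv, hAv⟩ := exists_eigenvector_lamMin hA
  have h1 := dotProduct_mulVec_nonneg_of_bddBelow (isSymm_add_smul_one hA l)
    (c := shifted a b μ) (r := r + l * δ + μ * β) (fun x => by
      have := h x
      rw [q_add_smul_one_shifted]
      unfold lagrangian at this
      linarith) v
  rw [Matrix.add_mulVec, hAv, Matrix.smul_mulVec, Matrix.one_mulVec, ← add_smul,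
    dotProduct_smul, smul_eq_mul] at h1
  have hvv : 0 < v ⬝ᵥ v :=
    lt_of_le_of_ne (Finset.sum_nonneg fun i _ => mul_self_nonneg (v i))
      fun h => hv (dotProduct_self_eq_zero.mp h.symm)
  have := nonneg_of_mul_nonneg_left h1 hvv
  linarith

end eigenvalue

/-! ### Primal and dual values -/

section values

variable {n : ℕ} {A : Matrix (Fin n) (Fin n) ℝ} {a b : Fin n → ℝ} {δ β : ℝ}

theorem le_dStar {l μ c : ℝ} (hl : 0 ≤ l) (hμ : 0 ≤ μ)
    (h : ∀ x, c ≤ lagrangian A a δ x l + μ * (b ⬝ᵥ x - β)) : (c : EReal) ≤ dStar A a b δ β := by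
  refine le_iSup₂_of_le μ hμ ?_
  unfold dualFun
  rw [EReal.le_sub_iff_add_le (Or.inl (EReal.coe_ne_bot _)) (Or.inl (EReal.coe_ne_top _)),
    ← EReal.coe_add]
  refine le_iSup₂_of_le l hl (le_iInf fun x => EReal.coe_le_coe_iff.mpr ?_)
  linarith [h x]

theorem dStar_le {c : ℝ}
    (h : ∀ l μ r : ℝ, 0 ≤ l → 0 ≤ μ →
      (∀ x, r ≤ lagrangian A a δ x l + μ * (b ⬝ᵥ x - β)) → r ≤ c) :
    dStar A a b δ β ≤ c := by
  refine iSup₂_le fun μ hμ => EReal.sub_le_of_le_add ?_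
  rw [← EReal.coe_add]
  refine iSup₂_le fun l hl => EReal.ge_of_forall_gt_iff_ge.mp fun r hr => ?_
  rw [EReal.coe_le_coe_iff]
  have h1 := h l μ (r - μ * β) hl hμ fun x => by
    have := EReal.coe_lt_coe_iff.mp (hr.trans_le (iInf_le _ x))
    linarith
  linarith

theorem pStar_le {x : Fin n → ℝ} (hx : x ∈ feasible b δ β) :
    pStar A a b δ β ≤ (q A a x : EReal) :=
  iInf₂_le x hx

theorem dStar_le_q {x : Fin n → ℝ} (hx : x ∈ feasible b δ β) :
    dStar A a b δ β ≤ (q A a x : EReal) := by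
  refine dStar_le fun l μ r hl hμ h => (h x).trans ?_
  unfold lagrangian
  linarith [mul_nonpos_of_nonneg_of_nonpos hl hx.1, mul_nonpos_of_nonneg_of_nonpos hμ hx.2]

theorem strongDuality_of_le_dStar {x : Fin n → ℝ} (hx : x ∈ feasible b δ β)
    (h : (q A a x : EReal) ≤ dStar A a b δ β) : StrongDuality A a b δ β :=
  le_antisymm ((pStar_le hx).trans h) (le_iInf₂ fun _ hy => dStar_le_q hy)

theorem isCompact_feasible (b : Fin n → ℝ) (δ β : ℝ) : IsCompact (feasible b δ β) := by
  have hclosed : IsClosed (feasible b δ β) := by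
    have h1 : IsClosed {x : Fin n → ℝ | x ⬝ᵥ x - δ ≤ 0} :=
      isClosed_le (by fun_prop) continuous_const
    have h2 : IsClosed {x : Fin n → ℝ | b ⬝ᵥ x - β ≤ 0} :=
      isClosed_le (by fun_prop) continuous_const
    exact h1.inter h2
  refine (isCompact_closedBall (0 : Fin n → ℝ) √δ).of_isClosed_subset hclosed fun x hx => ?_
  rw [mem_closedBall_zero_iff, pi_norm_le_iff_of_nonneg (Real.sqrt_nonneg δ)]
  intro i
  rw [Real.norm_eq_abs]
  refine Real.abs_le_sqrt ?_
  have h1 : x i * x i ≤ x ⬝ᵥ x :=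
    Finset.single_le_sum (f := fun i => x i * x i) (fun j _ => mul_self_nonneg (x j))
      (Finset.mem_univ i)
  have h2 := hx.1
  nlinarith

theorem exists_isMinOn_q (M : Matrix (Fin n) (Fin n) ℝ) (c : Fin n → ℝ)
    (hne : (feasible b δ β).Nonempty) :
    ∃ z ∈ feasible b δ β, ∀ x ∈ feasible b δ β, q M c z ≤ q M c x :=
  (isCompact_feasible b δ β).exists_isMinOn hne (continuous_q M c).continuousOn

/-- The convex relaxation with objective `q A a x + l * (x ⬝ᵥ x - δ)` has a minimizer and Lagrange
multipliers. -/
theorem exists_minimizer_multipliers {l : ℝ}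
    (hM : (A + l • (1 : Matrix (Fin n) (Fin n) ℝ)).PosSemidef)
    (hSlater : ∃ x : Fin n → ℝ, x ⬝ᵥ x < δ ∧ b ⬝ᵥ x < β) :
    ∃ z ∈ feasible b δ β, ∃ k μ : ℝ, 0 ≤ k ∧ 0 ≤ μ ∧
      ∀ x, lagrangian A a δ z l ≤ lagrangian A a δ x (l + k) + μ * (b ⬝ᵥ x - β) := by
  have hne : (feasible b δ β).Nonempty := by
    obtain ⟨x, h1, h2⟩ := hSlater
    exact ⟨x, by linarith, by linarith⟩
  obtain ⟨z, hz, hmin⟩ := exists_isMinOn_q (A + l • (1 : Matrix (Fin n) (Fin n) ℝ)) a hne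
  have hball : ConvexOn ℝ Set.univ fun x : Fin n → ℝ => x ⬝ᵥ x - δ := by
    have h := (convexOn_q (n := n) Matrix.PosSemidef.one 0).add_const (-δ)
    refine h.congr fun x _ => ?_
    simp [q, sub_eq_add_neg]
  have hhalf : ConvexOn ℝ Set.univ fun x : Fin n → ℝ => b ⬝ᵥ x - β := by
    refine ⟨convex_univ, fun x _ y _ s t _ _ hst => le_of_eq ?_⟩
    simp only [dotProduct_add, dotProduct_smul, smul_eq_mul]
    linear_combination β * hst
  obtain ⟨k, μ, hk, hμ, h⟩ := exists_multipliers (convexOn_q hM a) hball hhalf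
    (fun x hx1 hx2 => hmin x ⟨hx1, hx2⟩)
    (hSlater.imp fun x hx => ⟨by linarith [hx.1], by linarith [hx.2]⟩)
  refine ⟨z, hz, k, μ, hk, hμ, fun x => ?_⟩
  have h1 := h x
  rw [q_add_smul_one, q_add_smul_one] at h1
  unfold lagrangian
  linarith

end values

/-! ### Hard-case solutions and failure of duality -/

section hardCase

variable {n : ℕ} {A : Matrix (Fin n) (Fin n) ℝ} {a b : Fin n → ℝ} {δ β : ℝ}

theorem exists_nonneg_dotProduct_eq {z v : Fin n → ℝ} (hv : v ≠ 0) (hz : z ⬝ᵥ z ≤ δ) :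
    ∃ t : ℝ, 0 ≤ t ∧ (z + t • v) ⬝ᵥ (z + t • v) = δ := by
  have hvv : 0 < v ⬝ᵥ v :=
    lt_of_le_of_ne (Finset.sum_nonneg fun i _ => mul_self_nonneg (v i))
      fun h => hv (dotProduct_self_eq_zero.mp h.symm)
  -- The larger root of the quadratic equation for `t`.
  set D := (z ⬝ᵥ v) ^ 2 + (v ⬝ᵥ v) * (δ - z ⬝ᵥ z) with hD
  have hD1 : (z ⬝ᵥ v) ^ 2 ≤ D := by
    linarith [mul_nonneg hvv.le (sub_nonneg.mpr hz)]
  have hD0 : 0 ≤ D := (sq_nonneg _).trans hD1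
  refine ⟨(√D - z ⬝ᵥ v) / (v ⬝ᵥ v), div_nonneg ?_ hvv.le, ?_⟩
  · have := (le_abs_self _).trans (Real.abs_le_sqrt hD1)
    linarith
  · rw [dotProduct_add_smul_self]
    have hs := Real.sq_sqrt hD0
    field_simp
    linear_combination hs + hD

/-- The objective of the convex relaxation is constant along an eigenvector through a stationary
point `z`, so one of the two directions reaches the sphere without leaving the half-space. -/
theorem exists_feasible_q_eq [NeZero n] (hA : A.IsSymm) {z : Fin n → ℝ}
    (hz : z ∈ feasible b δ β)
    (hstat : (A + (-lamMin A) • (1 : Matrix (Fin n) (Fin n) ℝ)) *ᵥ z + a = 0) :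
    ∃ w ∈ feasible b δ β, q A a w = lagrangian A a δ z (-lamMin A) := by
  obtain ⟨v, hv, hAv, hbv⟩ : ∃ v : Fin n → ℝ, v ≠ 0 ∧ A *ᵥ v = lamMin A • v ∧ b ⬝ᵥ v ≤ 0 := by
    obtain ⟨v, hv, hAv⟩ := exists_eigenvector_lamMin hA
    rcases le_total (b ⬝ᵥ v) 0 with hbv | hbv
    · exact ⟨v, hv, hAv, hbv⟩
    · refine ⟨-v, neg_ne_zero.mpr hv, ?_, ?_⟩
      · rw [Matrix.mulVec_neg, hAv, smul_neg]
      · rw [dotProduct_neg]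
        linarith
  obtain ⟨t, ht, hsphere⟩ := exists_nonneg_dotProduct_eq hv (sub_nonpos.mp hz.1)
  refine ⟨z + t • v, ⟨by linarith, ?_⟩, ?_⟩
  · have h1 := hz.2
    rw [dotProduct_add, dotProduct_smul, smul_eq_mul]
    linarith [mul_nonpos_of_nonneg_of_nonpos ht hbv]
  · have h1 := q_add_smul (isSymm_add_smul_one hA (-lamMin A)) a z v t
    have h2 : (A + (-lamMin A) • (1 : Matrix (Fin n) (Fin n) ℝ)) *ᵥ v = 0 := by
      rw [Matrix.add_mulVec, hAv, Matrix.smul_mulVec, Matrix.one_mulVec]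
      module
    rw [hstat, h2, q_add_smul_one, q_add_smul_one, hsphere] at h1
    simp only [zero_dotProduct, dotProduct_zero] at h1
    unfold lagrangian
    linarith

theorem exists_isHardCaseSolution_of_not_strongDuality [NeZero n] (hA : A.IsSymm)
    (hSlater : ∃ x : Fin n → ℝ, x ⬝ᵥ x < δ ∧ b ⬝ᵥ x < β) (hSD : ¬ StrongDuality A a b δ β) :
    ∃ μ : ℝ, 0 < μ ∧ ∃ x : Fin n → ℝ, IsHardCaseSolution A a b δ β μ x := by
  -- If `A` is positive semidefinite, eTRS is its own convex relaxation (shift `0`).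
  have hneg : lamMin A < 0 := by
    by_contra! h0
    obtain ⟨z, hz, k, μ, hk, hμ, h⟩ := exists_minimizer_multipliers (a := a)
      (posSemidef_add_smul_one hA (l := 0) (by linarith)) hSlater
    refine hSD (strongDuality_of_le_dStar hz ?_)
    have h1 := le_dStar (add_nonneg le_rfl hk) hμ h
    simpa [lagrangian] using h1
  have hPSD := posSemidef_add_smul_one hA (le_refl (-lamMin A))
  obtain ⟨z, hz, k, μ, hk, hμ, h⟩ := exists_minimizer_multipliers (a := a) hPSD hSlater
  have hd := le_dStar (add_nonneg (by linarith) hk) hμ h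
  have hnot : ∀ w ∈ feasible b δ β, q A a w ≠ lagrangian A a δ z (-lamMin A) :=
    fun w hw heq => hSD (strongDuality_of_le_dStar hw (heq ▸ hd))
  have hlt : z ⬝ᵥ z < δ := by
    refine lt_of_le_of_ne (sub_nonpos.mp hz.1) fun heq => hnot z hz ?_
    simp [lagrangian, heq]
  -- Complementary slackness, from the multiplier inequality at `z` itself.
  have hzz := h z
  simp only [lagrangian] at hzz
  have hk1 := mul_nonpos_of_nonneg_of_nonpos hk hz.1
  have hμ1 := mul_nonpos_of_nonneg_of_nonpos hμ hz.2
  have hk0 : k = 0 := by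
    have : k * (z ⬝ᵥ z - δ) = 0 := by linarith
    exact (mul_eq_zero.mp this).resolve_right (by linarith)
  have hμ0 : μ * (b ⬝ᵥ z - β) = 0 := by linarith
  subst hk0
  have hstat := mulVec_add_eq_zero_of_forall_le (isSymm_add_smul_one hA (-lamMin A))
    (c := shifted a b μ) (z := z) (fun x => by
      have := h x
      simp only [lagrangian] at this
      rw [q_add_smul_one_shifted, q_add_smul_one_shifted]
      linarith)
  have hμpos : 0 < μ := by
    refine hμ.lt_of_ne fun h0 => ?_
    subst h0
    obtain ⟨w, hw, heq⟩ := exists_feasible_q_eq hA hz (by simpa [shifted] using hstat)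
    exact hnot w hw heq
  refine ⟨μ, hμpos, z, fun v hv => ?_, ⟨_, rfl, by linarith, hPSD, eq_neg_of_add_eq_zero_left hstat,
    mul_ne_zero (by linarith) (by linarith)⟩, hlt, ?_⟩
  · have h1 : (A + (-lamMin A) • (1 : Matrix (Fin n) (Fin n) ℝ)) *ᵥ v = 0 := by
      rw [Matrix.add_mulVec, hv, Matrix.smul_mulVec, Matrix.one_mulVec]
      module
    rw [eq_neg_of_add_eq_zero_right hstat, neg_dotProduct,
      ← dotProduct_mulVec_symm (isSymm_add_smul_one hA _), h1, dotProduct_zero, neg_zero]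
  · have := (mul_eq_zero.mp hμ0).resolve_left hμpos.ne'
    linarith

theorem not_strongDuality_of_isHardCaseSolution [NeZero n] (hA : A.IsSymm)
    (hv : lamMin A < 0 → ∀ v : Fin n → ℝ, v ≠ 0 → A *ᵥ v = lamMin A • v →
      ¬ (a ⬝ᵥ v = 0 ∧ b ⬝ᵥ v = 0))
    {μ : ℝ} (hμ : 0 < μ) {x : Fin n → ℝ} (hx : IsHardCaseSolution A a b δ β μ x) :
    ¬ StrongDuality A a b δ β := by
  intro hSD
  obtain ⟨hhard, ⟨l, hl, hl0, hPSD, hstat, hcs⟩, hlt, hbx⟩ := hx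
  have hlpos : 0 < l := hl0.lt_of_ne fun h => hcs (by rw [← h, zero_mul])
  have hneg : lamMin A < 0 := by linarith
  have hxf : x ∈ feasible b δ β := ⟨by linarith, by linarith⟩
  obtain ⟨y, hy, hmin⟩ := exists_isMinOn_q A a ⟨x, hxf⟩
  have hdual : dStar A a b δ β ≤ (lagrangian A a δ x l : ℝ) := by
    refine dStar_le fun l' μ' r _ _ h => (h x).trans ?_
    have hll : l ≤ l' := hl ▸ neg_lamMin_le_of_bddBelow hA h
    rw [hbx]
    unfold lagrangian
    linarith [mul_nonneg (sub_nonneg.mpr hll) (sub_nonneg.mpr hlt.le)]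
  have hqy : q A a y ≤ lagrangian A a δ x l := by
    have hp : (q A a y : EReal) ≤ pStar A a b δ β :=
      le_iInf₂ fun w hw => EReal.coe_le_coe_iff.mpr (hmin w hw)
    have hpd : pStar A a b δ β = dStar A a b δ β := hSD
    rw [hpd] at hp
    exact EReal.coe_le_coe_iff.mp (hp.trans hdual)
  have hexp := q_add (isSymm_add_smul_one hA l) (shifted a b μ) x (y - x)
  rw [add_sub_cancel, hstat, neg_add_cancel, zero_dotProduct, q_add_smul_one_shifted,
    q_add_smul_one_shifted, hbx] at hexp
  have hcurv := posSemidef_dotProduct_nonneg hPSD (y - x)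
  have hl1 := mul_nonpos_of_nonneg_of_nonpos hl0 hy.1
  have hμ1 := mul_nonpos_of_nonneg_of_nonpos hμ.le hy.2
  unfold lagrangian at hqy
  -- The chain `q y ≤ L x ≤ L y ≤ q y` collapses, so each of its slack terms vanishes.
  have hysphere : y ⬝ᵥ y - δ = 0 :=
    (mul_eq_zero.mp (by linarith : l * (y ⬝ᵥ y - δ) = 0)).resolve_left hlpos.ne'
  have hyb : b ⬝ᵥ y - β = 0 :=
    (mul_eq_zero.mp (by linarith : μ * (b ⬝ᵥ y - β) = 0)).resolve_left hμ.ne'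
  have hker : (A + l • (1 : Matrix (Fin n) (Fin n) ℝ)) *ᵥ (y - x) = 0 := by
    rw [← hPSD.dotProduct_mulVec_zero_iff, star_trivial]
    linarith
  have heig : A *ᵥ (y - x) = lamMin A • (y - x) := by
    rw [Matrix.add_mulVec, Matrix.smul_mulVec, Matrix.one_mulVec, hl, neg_smul] at hker
    exact add_neg_eq_zero.mp hker
  have hbd : b ⬝ᵥ (y - x) = 0 := by
    rw [dotProduct_sub]
    linarith
  have had : a ⬝ᵥ (y - x) = 0 := by
    have := hhard _ heig
    rw [shifted, add_dotProduct, smul_dotProduct, hbd, smul_zero, add_zero] at this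
    exact this
  have hyx : y = x := by
    by_contra hne
    exact hv hneg _ (sub_ne_zero.mpr hne) heig ⟨had, hbd⟩
  rw [hyx] at hysphere
  linarith

end hardCase

end ETRS

theorem mainTheorem2 {n : ℕ} (A : Matrix (Fin n) (Fin n) ℝ) (hA : A.IsSymm)
    (a b : Fin n → ℝ) (ha : a ≠ 0) (hb : b ≠ 0) (δ β : ℝ) (hδ : 0 < δ)
    (hSlater : ∃ x : Fin n → ℝ, x ⬝ᵥ x < δ ∧ b ⬝ᵥ x < β) :
    (¬ ETRS.StrongDuality A a b δ β →
      ∃ μ : ℝ, 0 < μ ∧ ∃ x : Fin n → ℝ, ETRS.IsHardCaseSolution A a b δ β μ x) ∧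
    ((ETRS.lamMin A < 0 → ∀ v : Fin n → ℝ, v ≠ 0 → A *ᵥ v = ETRS.lamMin A • v →
        ¬ (a ⬝ᵥ v = 0 ∧ b ⬝ᵥ v = 0)) →
      (¬ ETRS.StrongDuality A a b δ β ↔
        ∃ μ : ℝ, 0 < μ ∧ ∃ x : Fin n → ℝ, ETRS.IsHardCaseSolution A a b δ β μ x)) := by
  have : NeZero n := ⟨by
    rintro rfl
    exact ha (Subsingleton.elim _ _)⟩
  have key := ETRS.exists_isHardCaseSolution_of_not_strongDuality (a := a) hA hSlater
  exact ⟨key, fun hv => ⟨key, fun ⟨_, hμ, _, hx⟩ =>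
    ETRS.not_strongDuality_of_isHardCaseSolution hA hv hμ hx⟩⟩
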